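/- Let $d\ge 1$ and fix the standard basis of $\mathbb C^d$. A state is a positive semidefinite $d\times d$ complex matrix of unit trace; a pure state is a unit vector $\psi\in\mathbb C^d$, identified with the state $|\psi\rangle\langle\psi|$, and it is called real if all its coordinates in the fixed basis are real. The fidelity of two states is $$F(\rho,\sigma)=\Big(\operatorname{tr}\sqrt{\sqrt{\rho}\,\sigma\sqrt{\rho}}\Big)^2 .$$ The geometric imaginarity of a pure state $\psi$ is $\mathscr I_g(\psi)=1-\max_{\phi}|\langle\phi|\psi\rangle|^2$, where $\phi$ ranges over all real pure states, and that of a state $\rho$ is $$\mathscr I_g(\rho)=\min\sum_j p_j\,\mathscr I_g(\psi_j),$$ where the minimum is over all finite decompositions $\rho=\sum_j p_j|\psi_j\rangle\langle\psi_j|$ of $\rho$ into pure states $\psi_j$ with probabilities $p_j\ge 0$, $\sum_j p_j=1$. For a state $\rho$ and $f\in[0,1]$ let $S_{\rho,f}$ be the set of all states $\rho'$ on $\mathbb C^d$ with $F(\rho,\rho')\ge f$, and write $S_{\psi,f}=S_{|\psi\rangle\langle\psi|,f}$. **Theorem.** Let $f\in[0,1]$. For every state $\rho$, the minimum of $\mathscr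 I_g$ over $S_{\rho,f}$ is attained and $$\min_{\rho'\in S_{\rho,f}}\mathscr I_g(\rho')=\sin^2\Big(\max\big\{\sin^{-1}\!\sqrt{\mathscr I_g(\rho)}-\cos^{-1}\!\sqrt f,\;0\big\}\Big).$$ If $d\ge 2$, then for every pure state $\psi$ the maximum of $\mathscr I_g$ over $S_{\psi,f}$ is attained and $$\max_{\rho'\in S_{\psi,f}}\mathscr I_g(\rho')=\sin^2\Big(\min\big\{\sin^{-1}\!\sqrt{\mathscr I_g(\psi)}+\cos^{-1}\!\sqrt f,\;\tfrac{\pi}{4}\big\}\Big).$$ -/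

import Mathlib

namespace Imaginarity

section

open scoped MatrixOrder ComplexOrder

variable {ι : Type*} [Fintype ι]

/-- A quantum state (density matrix, written in the fixed reference basis): a positive
semidefinite matrix of unit trace. -/
def IsState (ρ : Matrix ι ι ℂ) : Prop :=
  ρ.PosSemidef ∧ ρ.trace = 1

/-- The matrix `|ψ⟩⟨ψ|`, with entries `ψ i * conj (ψ j)`. -/
noncomputable def ketBra (ψ : EuclideanSpace ℂ ι) : Matrix ι ι ℂ :=
  Matrix.of fun i j => ψ i * starRingEnd ℂ (ψ j)

/-- A real pure state: a unit vector with real coefficients in the reference basis. -/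
def IsRealPure (φ : EuclideanSpace ℂ ι) : Prop :=
  ‖φ‖ = 1 ∧ ∀ i, (φ i).im = 0

/-- The fidelity `F(ρ, σ) = (tr √(√ρ σ √ρ))²`. For positive semidefinite arguments the trace is
a nonnegative real number, so taking its real part loses nothing. -/
noncomputable def fidelity [DecidableEq ι] (ρ σ : Matrix ι ι ℂ) : ℝ :=
  ((CFC.sqrt (CFC.sqrt ρ * σ * CFC.sqrt ρ)).trace.re) ^ 2

/-- The geometric imaginarity of a pure state:
`1 - max |⟨φ|ψ⟩|²`, the maximum being over all real pure states `φ`. -/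
noncomputable def geomImagPure (ψ : EuclideanSpace ℂ ι) : ℝ :=
  1 - sSup {x : ℝ | ∃ φ : EuclideanSpace ℂ ι, IsRealPure φ ∧ x = ‖inner ℂ φ ψ‖ ^ 2}

/-- `ρ = ∑ j, p j |ψ j⟩⟨ψ j|` is a decomposition of `ρ` into (finitely many) pure states, with
probabilities `p j`. -/
def IsPureDecomposition (ρ : Matrix ι ι ℂ) {k : ℕ} (p : Fin k → ℝ)
    (ψ : Fin k → EuclideanSpace ℂ ι) : Prop :=
  (∀ j, 0 ≤ p j) ∧ ∑ j, p j = 1 ∧ (∀ j, ‖ψ j‖ = 1) ∧ ρ = ∑ j, (p j : ℂ) • ketBra (ψ j)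

/-- The geometric imaginarity of a (mixed) state: the minimal average geometric imaginarity over
all its pure-state decompositions. -/
noncomputable def geomImag (ρ : Matrix ι ι ℂ) : ℝ :=
  sInf {x : ℝ | ∃ (k : ℕ) (p : Fin k → ℝ) (ψ : Fin k → EuclideanSpace ℂ ι),
    IsPureDecomposition ρ p ψ ∧ x = ∑ j, p j * geomImagPure (ψ j)}

/-- The set `S_{ρ,f}` of the states `ρ'` with `F(ρ, ρ') ≥ f`. -/
def fidelityBall [DecidableEq ι] (ρ : Matrix ι ι ℂ) (f : ℝ) : Set (Matrix ι ι ℂ) :=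
  {ρ' | IsState ρ' ∧ f ≤ fidelity ρ ρ'}

end

end Imaginarity

/-! Write a state as `ρ = A * Aᴴ` and regard the purification `A` as a unit vector of the
Hilbert–Schmidt space. The columns of `A` are a pure-state decomposition of `ρ`, and a real matrix
`B` of norm one has real pure states (with weights) as columns. Cauchy–Schwarz over the columns,
with equality when the column norms of `B` are proportional to the overlaps, shows that `1 -
geomImag ρ` is the largest squared overlap of a purification of `ρ` with such a `B`. Thus `geomImag
ρ = sin² θ`, where `θ` is an angular distance from `ρ` to the real matrices (`exists_angle`).

Uhlmann's theorem (`norm_inner_hsVec_le`, `exists_purification_inner_eq`) identifies the root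
fidelity with the best overlap of purifications. It lets matrices with any number of columns be
replaced by square ones, and together with the triangle inequality for angles between rays it shows
that `θ` varies by at most `arccos √f` over the fidelity ball (`angle_le_add`). This yields both
bounds.

The minimum is attained by moving `A` along the geodesic towards its nearest real `B`. For the
maximum, a pure state is, up to phase, `cos θ e + i sin θ e'` with `e`, `e'` real orthonormal and `θ
≤ π/4`, and its angle can be increased within that plane. The cap `π/4` is the universal bound
`geomImag ≤ 1/2`. -/

namespace Imaginarity

open Matrix
open scoped MatrixOrder ComplexOrder

/-! ### Unitary freedom of purifications and the Hilbert–Schmidt inner product -/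

section HilbertSchmidt

variable {ι κ : Type*} [Fintype ι] [Fintype κ]

/-- Two linear maps with the same pointwise norms differ by an isometry of the codomain. -/
lemma exists_linearIsometry_comp_eq {E F : Type*} [NormedAddCommGroup E] [InnerProductSpace ℂ E]
    [NormedAddCommGroup F] [InnerProductSpace ℂ F] [FiniteDimensional ℂ F]
    (f g : E →ₗ[ℂ] F) (h : ∀ x, ‖f x‖ = ‖g x‖) :
    ∃ L : F →ₗᵢ[ℂ] F, ∀ x, f x = L (g x) := by
  obtain ⟨s, hs⟩ := LinearMap.exists_rightInverse_of_surjective g.rangeRestrict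
    (LinearMap.range_rangeRestrict g)
  have hgs : ∀ y : LinearMap.range g, g (s y) = y := fun y => by
    have := LinearMap.congr_fun hs y
    exact congrArg Subtype.val this
  let L₀ : LinearMap.range g →ₗᵢ[ℂ] F :=
    { toLinearMap := f ∘ₗ s
      norm_map' := fun y => by
        change ‖f (s y)‖ = ‖y‖
        rw [h, hgs]; rfl }
  refine ⟨L₀.extend, fun x => ?_⟩
  have hx : L₀.extend (g x) = L₀ ⟨g x, LinearMap.mem_range_self g x⟩ :=
    LinearIsometry.extend_apply L₀ ⟨g x, LinearMap.mem_range_self g x⟩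
  rw [hx]
  change f x = f (s _)
  -- Equal norms give `f` and `g` the same kernel, so the choice of preimage made by `s` does not
  -- matter.
  rw [← sub_eq_zero, ← map_sub, ← norm_eq_zero, h, map_sub, hgs, sub_self, norm_zero]

/-- If `A * Aᴴ = B * Bᴴ`, then `A` and `B` differ by a unitary on the right. -/
lemma exists_unitary_eq_mul [DecidableEq κ] (A B : Matrix ι κ ℂ) (h : A * Aᴴ = B * Bᴴ) :
    ∃ V : Matrix κ κ ℂ, V * Vᴴ = 1 ∧ A = B * V := by
  classical
  have key : ∀ (M : Matrix ι κ ℂ) (x : EuclideanSpace ℂ ι),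
      inner ℂ (toEuclideanLin Mᴴ x) (toEuclideanLin Mᴴ x)
        = inner ℂ (toEuclideanLin (M * Mᴴ) x) x := fun M x => by
    rw [← LinearMap.adjoint_inner_left, ← toEuclideanLin_conjTranspose_eq_adjoint,
      conjTranspose_conjTranspose]
    congr 1
    simp
  obtain ⟨L, hL⟩ := exists_linearIsometry_comp_eq (toEuclideanLin Aᴴ) (toEuclideanLin Bᴴ)
    (fun x => by
      have h1 := key A x
      rw [h, ← key B x, inner_self_eq_norm_sq_to_K, inner_self_eq_norm_sq_to_K] at h1
      have h2 : ‖toEuclideanLin Aᴴ x‖ ^ 2 = ‖toEuclideanLin Bᴴ x‖ ^ 2 := by exact_mod_cast h1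
      exact (sq_eq_sq₀ (norm_nonneg _) (norm_nonneg _)).1 h2)
  obtain ⟨W, hW⟩ := (toEuclideanLin (𝕜 := ℂ) (m := κ) (n := κ)).surjective L.toLinearMap
  have hA : Aᴴ = W * Bᴴ := by
    apply (toEuclideanLin (𝕜 := ℂ)).injective
    ext1 x
    rw [hL, ← LinearIsometry.coe_toLinearMap, ← hW]
    simp
  refine ⟨Wᴴ, ?_, ?_⟩
  · rw [conjTranspose_conjTranspose]
    apply (toEuclideanLin (𝕜 := ℂ)).injective
    ext1 x
    refine ext_inner_right ℂ fun y => ?_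
    have : toEuclideanLin (Wᴴ * W) x = toEuclideanLin Wᴴ (toEuclideanLin W x) := by
      simp
    rw [this, toEuclideanLin_conjTranspose_eq_adjoint, LinearMap.adjoint_inner_left, hW]
    simp
  · have := congrArg conjTranspose hA
    simpa using this

/-- A matrix, seen as a vector of the Hilbert–Schmidt space. -/
noncomputable def hsVec (A : Matrix ι κ ℂ) : EuclideanSpace ℂ (ι × κ) :=
  WithLp.toLp 2 fun p => A p.1 p.2

lemma inner_hsVec (A B : Matrix ι κ ℂ) : inner ℂ (hsVec A) (hsVec B) = (Aᴴ * B).trace := by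
  rw [PiLp.inner_apply, Fintype.sum_prod_type, Finset.sum_comm]
  simp [hsVec, trace, mul_apply, mul_comm]

lemma norm_hsVec_sq (A : Matrix ι κ ℂ) : ‖hsVec A‖ ^ 2 = (A * Aᴴ).trace.re := by
  rw [trace_mul_comm, ← inner_hsVec, inner_self_eq_norm_sq_to_K]
  norm_cast

lemma norm_hsVec_eq_one {A : Matrix ι κ ℂ} (hA : (A * Aᴴ).trace = 1) : ‖hsVec A‖ = 1 := by
  have := norm_hsVec_sq A
  rw [hA] at this
  exact (pow_eq_one_iff_of_nonneg (norm_nonneg _) two_ne_zero).1 (by simpa using this)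

end HilbertSchmidt

/-! ### Uhlmann's theorem -/

section Uhlmann

variable {ι κ : Type*} [Fintype ι] [Fintype κ] [DecidableEq ι]

lemma sqrt_mul_sqrt_of_posSemidef {P : Matrix ι ι ℂ} (hP : P.PosSemidef) :
    CFC.sqrt P * CFC.sqrt P = P :=
  CFC.sqrt_mul_sqrt_self P (nonneg_iff_posSemidef.2 hP)

lemma conjTranspose_sqrt (P : Matrix ι ι ℂ) : (CFC.sqrt P)ᴴ = CFC.sqrt P :=
  (nonneg_iff_posSemidef.1 (CFC.sqrt_nonneg P)).isHermitian

/-- The square root `√F` of the fidelity. -/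
noncomputable def rootFidelity (ρ σ : Matrix ι ι ℂ) : ℝ :=
  (CFC.sqrt (CFC.sqrt ρ * σ * CFC.sqrt ρ)).trace.re

lemma rootFidelity_nonneg (ρ σ : Matrix ι ι ℂ) : 0 ≤ rootFidelity ρ σ :=
  (Complex.nonneg_iff.1 (nonneg_iff_posSemidef.1 (CFC.sqrt_nonneg _)).trace_nonneg).1

lemma fidelity_eq_sq (ρ σ : Matrix ι ι ℂ) : fidelity ρ σ = rootFidelity ρ σ ^ 2 := rfl

lemma sqrt_mul_mul_sqrt (ρ : Matrix ι ι ℂ) (B : Matrix ι κ ℂ) :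
    CFC.sqrt (CFC.sqrt ρ * (B * Bᴴ) * CFC.sqrt ρ) * CFC.sqrt (CFC.sqrt ρ * (B * Bᴴ) * CFC.sqrt ρ)
      = (CFC.sqrt ρ * B) * (CFC.sqrt ρ * B)ᴴ := by
  rw [sqrt_mul_sqrt_of_posSemidef, conjTranspose_mul, conjTranspose_sqrt]
  · simp only [Matrix.mul_assoc]
  · have := posSemidef_self_mul_conjTranspose (CFC.sqrt ρ * B)
    rw [conjTranspose_mul, conjTranspose_sqrt] at this
    simpa only [Matrix.mul_assoc] using this

/-- The coisometry `J` widens the square roots `R` and `P` to the shape of `A` without changing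
their Gram matrices, so that `A = R * J * V` and `R * B = P * J * W` with `V`, `W` unitary.
Splitting `P = Q * Q` turns the overlap into one of two vectors of squared norm `tr P`, and
Cauchy–Schwarz finishes. -/
lemma norm_inner_hsVec_le_of_coisometry [DecidableEq κ] {J : Matrix ι κ ℂ} (hJ : J * Jᴴ = 1)
    (A B : Matrix ι κ ℂ) :
    ‖inner ℂ (hsVec A) (hsVec B)‖ ≤ rootFidelity (A * Aᴴ) (B * Bᴴ) := by
  unfold rootFidelity
  set R := CFC.sqrt (A * Aᴴ) with hR
  have hRR : R * R = A * Aᴴ := sqrt_mul_sqrt_of_posSemidef (posSemidef_self_mul_conjTranspose A)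
  have hRh : Rᴴ = R := conjTranspose_sqrt _
  set P := CFC.sqrt (R * (B * Bᴴ) * R) with hP
  have hPP : P * P = (R * B) * (R * B)ᴴ := sqrt_mul_mul_sqrt _ B
  have hPh : Pᴴ = P := conjTranspose_sqrt _
  set Q := CFC.sqrt P with hQ
  have hQQ : Q * Q = P :=
    sqrt_mul_sqrt_of_posSemidef (nonneg_iff_posSemidef.1 (CFC.sqrt_nonneg _))
  have hQh : Qᴴ = Q := conjTranspose_sqrt _
  have hJJ : ∀ X : Matrix ι ι ℂ, Xᴴ = X → (X * J) * (X * J)ᴴ = X * X := fun X hX => by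
    rw [conjTranspose_mul, hX, Matrix.mul_assoc, ← Matrix.mul_assoc J, hJ, Matrix.one_mul]
  obtain ⟨V, hV, hAV⟩ := exists_unitary_eq_mul A (R * J) (by rw [hJJ R hRh, hRR])
  obtain ⟨W, hW, hBW⟩ := exists_unitary_eq_mul (R * B) (P * J) (by rw [hJJ P hPh, hPP])
  have h1 : inner ℂ (hsVec A) (hsVec B) = inner ℂ (hsVec (Q * J * V)) (hsVec (Q * J * W)) := by
    rw [inner_hsVec, inner_hsVec, hAV]
    congr 1
    calc (R * J * V)ᴴ * B = (J * V)ᴴ * (R * B) := by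
          rw [Matrix.mul_assoc R, conjTranspose_mul, hRh]; simp only [Matrix.mul_assoc]
      _ = _ := by
          rw [hBW, ← hQQ, Matrix.mul_assoc Q J V, conjTranspose_mul Q, hQh]
          simp only [Matrix.mul_assoc]
  have h2 : ∀ U : Matrix κ κ ℂ, U * Uᴴ = 1 → ‖hsVec (Q * J * U)‖ ^ 2 = P.trace.re := by
    intro U hU
    rw [norm_hsVec_sq, conjTranspose_mul, Matrix.mul_assoc, ← Matrix.mul_assoc U, hU,
      Matrix.one_mul, hJJ Q hQh, hQQ]
  rw [h1]
  refine (norm_inner_le_norm _ _).trans ?_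
  nlinarith [h2 V hV, h2 W hW, sq_nonneg (‖hsVec (Q * J * V)‖ - ‖hsVec (Q * J * W)‖)]

/-- Overlaps of purifications are bounded by the fidelity. -/
lemma norm_inner_hsVec_le (A B : Matrix ι κ ℂ) :
    ‖inner ℂ (hsVec A) (hsVec B)‖ ≤ rootFidelity (A * Aᴴ) (B * Bᴴ) := by
  classical
  -- Zero columns change neither Gram matrices nor overlaps, and they provide a coisometry even when
  -- `κ` is smaller than `ι`.
  have h := norm_inner_hsVec_le_of_coisometry (ι := ι) (κ := κ ⊕ ι)
    (J := fromCols 0 1) (by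
      rw [conjTranspose_fromCols_eq_fromRows_conjTranspose, fromCols_mul_fromRows]; simp)
    (fromCols A 0) (fromCols B 0)
  simp only [conjTranspose_fromCols_eq_fromRows_conjTranspose, fromCols_mul_fromRows,
    conjTranspose_zero, Matrix.mul_zero, add_zero] at h
  convert h using 2
  rw [PiLp.inner_apply, PiLp.inner_apply, Fintype.sum_prod_type, Fintype.sum_prod_type]
  simp [hsVec, Fintype.sum_sum_type]

/-- The fidelity is attained as an overlap of purifications, one of which may be prescribed. -/
lemma exists_purification_inner_eq {ρ : Matrix ι ι ℂ} (hρ : ρ.PosSemidef) (B : Matrix ι ι ℂ) :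
    ∃ A : Matrix ι ι ℂ, A * Aᴴ = ρ ∧
      inner ℂ (hsVec A) (hsVec B) = (rootFidelity ρ (B * Bᴴ) : ℂ) := by
  unfold rootFidelity
  set R := CFC.sqrt ρ with hR
  have hRR : R * R = ρ := sqrt_mul_sqrt_of_posSemidef hρ
  have hRh : Rᴴ = R := conjTranspose_sqrt _
  set P := CFC.sqrt (R * (B * Bᴴ) * R) with hP
  have hPP : P * P = (R * B) * (R * B)ᴴ := sqrt_mul_mul_sqrt _ B
  have hPh : Pᴴ = P := conjTranspose_sqrt _
  obtain ⟨W, hW, hBW⟩ := exists_unitary_eq_mul (R * B) P (by rw [hPh, hPP])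
  -- By the polar decomposition `R * B = P * W`, the overlap of `R * W` with `B` is `tr (Wᴴ * P * W)
  -- = tr P`.
  refine ⟨R * W, ?_, ?_⟩
  · rw [conjTranspose_mul, Matrix.mul_assoc, ← Matrix.mul_assoc W, hW, Matrix.one_mul, hRh, hRR]
  · rw [inner_hsVec, conjTranspose_mul, hRh, Matrix.mul_assoc, hBW, ← Matrix.mul_assoc,
      trace_mul_comm, ← Matrix.mul_assoc, hW, Matrix.one_mul]
    have h0 : 0 ≤ P.trace := (nonneg_iff_posSemidef.1 (CFC.sqrt_nonneg _)).trace_nonneg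
    exact (Complex.ext rfl (by simpa using (Complex.nonneg_iff.1 h0).2.symm))

/-- An overlap attaining one fidelity is, read backwards, bounded by the other. -/
lemma rootFidelity_le_comm {ρ σ : Matrix ι ι ℂ} (hρ : ρ.PosSemidef) (hσ : σ.PosSemidef) :
    rootFidelity ρ σ ≤ rootFidelity σ ρ := by
  have hs : CFC.sqrt σ * (CFC.sqrt σ)ᴴ = σ := by
    rw [conjTranspose_sqrt, sqrt_mul_sqrt_of_posSemidef hσ]
  obtain ⟨A, hA, h⟩ := exists_purification_inner_eq hρ (CFC.sqrt σ)
  have h2 := norm_inner_hsVec_le (CFC.sqrt σ) A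
  rw [norm_inner_symm, h, hs, hA, Complex.norm_real, Real.norm_eq_abs,
    abs_of_nonneg (rootFidelity_nonneg _ _)] at h2
  exact h2

end Uhlmann

/-! ### Angles between rays -/

section Angles

variable {E : Type*} [NormedAddCommGroup E] [InnerProductSpace ℂ E]

/-- Triangle inequality for the angle `arccos |⟨x, y⟩|` between rays. -/
lemma arccos_norm_inner_le_add {x y z : E} (hx : ‖x‖ = 1) (hy : ‖y‖ = 1) (hz : ‖z‖ = 1) :
    Real.arccos ‖inner ℂ x z‖ ≤ Real.arccos ‖inner ℂ x y‖ + Real.arccos ‖inner ℂ y z‖ := by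
  have hyy : inner ℂ y y = (1 : ℂ) := by
    rw [inner_self_eq_norm_sq_to_K, hy]; simp
  have hle : ∀ u v : E, ‖u‖ = 1 → ‖v‖ = 1 → ‖inner ℂ u v‖ ≤ 1 := fun u v hu hv => by
    simpa [hu, hv] using norm_inner_le_norm (𝕜 := ℂ) u v
  have hperp : ∀ u v : E, inner ℂ (u - inner ℂ y u • y) (v - inner ℂ y v • y)
      = inner ℂ u v - inner ℂ u y * inner ℂ y v := fun u v => by
    simp only [inner_sub_left, inner_sub_right, inner_smul_left, inner_smul_right, hyy,
      inner_conj_symm]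
    ring
  have hnorm : ∀ u : E, ‖u‖ = 1 → ‖u - inner ℂ y u • y‖ = √(1 - ‖inner ℂ y u‖ ^ 2) := fun u hu => by
    have h2 := hperp u u
    rw [inner_self_eq_norm_sq_to_K, inner_self_eq_norm_sq_to_K, hu, ← inner_conj_symm u y,
      RCLike.conj_mul] at h2
    have h3 : ‖u - inner ℂ y u • y‖ ^ 2 = 1 ^ 2 - ‖inner ℂ y u‖ ^ 2 := by exact_mod_cast h2
    rw [one_pow] at h3
    rw [← h3, Real.sqrt_sq (norm_nonneg _)]
  -- Cauchy–Schwarz for the components of `x` and `z` orthogonal to `y`; the left side is the cosine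
  -- of the sum of the two angles.
  have h1 : ‖inner ℂ x y‖ * ‖inner ℂ y z‖
      - √(1 - ‖inner ℂ x y‖ ^ 2) * √(1 - ‖inner ℂ y z‖ ^ 2) ≤ ‖inner ℂ x z‖ := by
    have h2 := norm_inner_le_norm (𝕜 := ℂ) (x - inner ℂ y x • y) (z - inner ℂ y z • y)
    rw [hperp, hnorm x hx, hnorm z hz, norm_inner_symm y x] at h2
    have h3 := norm_sub_norm_le (inner ℂ x y * inner ℂ y z) (inner ℂ x z)
    rw [norm_sub_rev, norm_mul] at h3
    linarith
  have h4 : Real.cos (Real.arccos ‖inner ℂ x y‖ + Real.arccos ‖inner ℂ y z‖) ≤ ‖inner ℂ x z‖ := by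
    rwa [Real.cos_add, Real.cos_arccos (by linarith [norm_nonneg (inner ℂ x y)]) (hle x y hx hy),
      Real.cos_arccos (by linarith [norm_nonneg (inner ℂ y z)]) (hle y z hy hz),
      Real.sin_arccos, Real.sin_arccos]
  have h5 := Real.arccos_le_pi_div_two.2 (norm_nonneg (inner ℂ x y))
  have h6 := Real.arccos_le_pi_div_two.2 (norm_nonneg (inner ℂ y z))
  calc Real.arccos ‖inner ℂ x z‖ ≤ Real.arccos (Real.cos _) := Real.arccos_le_arccos h4
    _ = _ := Real.arccos_cos 
        (add_nonneg (Real.arccos_nonneg _) (Real.arccos_nonneg _)) (by linarith)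

/-- Intermediate points on the geodesic from `y` to `x`. -/
lemma exists_geodesic_point {x y : E} (hx : ‖x‖ = 1) (hy : ‖y‖ = 1) {θ γ : ℝ}
    (hθ : θ ≤ Real.pi / 2) (hγ0 : 0 ≤ γ) (hγ : γ ≤ θ) (h : inner ℂ y x = (Real.cos θ : ℂ)) :
    ∃ z : E, ‖z‖ = 1 ∧ inner ℂ y z = (Real.cos γ : ℂ) ∧
      inner ℂ x z = (Real.cos (θ - γ) : ℂ) := by
  have hyy : inner ℂ y y = (1 : ℂ) := by
    rw [inner_self_eq_norm_sq_to_K, hy]; simp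
  have hxx : inner ℂ x x = (1 : ℂ) := by
    rw [inner_self_eq_norm_sq_to_K, hx]; simp
  have h' : inner ℂ x y = (Real.cos θ : ℂ) := by
    rw [← inner_conj_symm, h, Complex.conj_ofReal]
  rcases (hγ0.trans hγ).eq_or_lt with h0 | h0
  · obtain rfl : γ = 0 := by linarith
    refine ⟨y, hy, by rw [hyy]; simp, ?_⟩
    rw [h', sub_zero]
  have hs : Real.sin θ ≠ 0 := (Real.sin_pos_of_pos_of_lt_pi h0 (by linarith [Real.pi_pos])).ne'
  have hsc : (Real.sin θ : ℂ) ≠ 0 := by exact_mod_cast hs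
  have e1 : (Real.sin θ : ℂ) ^ 2 + (Real.cos θ : ℂ) ^ 2 = 1 := by
    exact_mod_cast Real.sin_sq_add_cos_sq θ
  have e2 : (Real.sin γ : ℂ) ^ 2 + (Real.cos γ : ℂ) ^ 2 = 1 := by
    exact_mod_cast Real.sin_sq_add_cos_sq γ
  -- Gram–Schmidt: `x = cos θ y + sin θ w`, with no phase because `⟨y, x⟩` is real.
  set w : E := (Real.sin θ : ℂ)⁻¹ • (x - (Real.cos θ : ℂ) • y) with hw
  have hyw : inner ℂ y w = (0 : ℂ) := by
    rw [hw, inner_smul_right, inner_sub_right, inner_smul_right, hyy, h]; ring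
  have hxw : inner ℂ x w = (Real.sin θ : ℂ) := by
    rw [hw, inner_smul_right, inner_sub_right, inner_smul_right, hxx, h']
    field_simp
    linear_combination -e1
  have hwy : inner ℂ w y = (0 : ℂ) := by rw [← inner_conj_symm, hyw, map_zero]
  have hww : inner ℂ w w = (1 : ℂ) := by
    nth_rewrite 1 [hw]
    rw [inner_smul_left, inner_sub_left, inner_smul_left, hxw, hyw, map_inv₀, Complex.conj_ofReal,
      mul_zero, sub_zero, inv_mul_cancel₀ hsc]
  set z : E := (Real.cos γ : ℂ) • y + (Real.sin γ : ℂ) • w with hz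
  refine ⟨z, ?_, ?_, ?_⟩
  · have : inner ℂ z z = (1 : ℂ) := by
      rw [hz]
      simp only [inner_add_left, inner_add_right, inner_smul_left, inner_smul_right, hyy, hyw, hwy,
        hww, Complex.conj_ofReal]
      linear_combination e2
    have h2 : ‖z‖ ^ 2 = 1 := by rw [← inner_self_eq_norm_sq (𝕜 := ℂ), this]; simp
    exact (pow_eq_one_iff_of_nonneg (norm_nonneg _) two_ne_zero).1 h2
  · rw [hz, inner_add_right, inner_smul_right, inner_smul_right, hyy, hyw]; ring
  · rw [hz, inner_add_right, inner_smul_right, inner_smul_right, h', hxw, Real.cos_sub]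
    push_cast; ring

end Angles

/-! ### Pure states and their canonical form -/

section Pure

variable {ι : Type*} [Fintype ι]

/-- The complexification of a real vector. -/
noncomputable def complexify (u : EuclideanSpace ℝ ι) : EuclideanSpace ℂ ι :=
  WithLp.toLp 2 fun i => (u i : ℂ)

lemma inner_complexify (u v : EuclideanSpace ℝ ι) :
    inner ℂ (complexify u) (complexify v) = (inner ℝ u v : ℂ) := by
  simp [PiLp.inner_apply, complexify]

lemma norm_complexify (u : EuclideanSpace ℝ ι) : ‖complexify u‖ = ‖u‖ := by
  simp [EuclideanSpace.norm_eq, complexify]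

lemma complexify_smul {κ : Type*} (r : ℝ) (u : EuclideanSpace ℝ κ) :
    complexify (r • u) = (r : ℂ) • complexify u := by
  ext i; simp [complexify]

lemma isRealPure_complexify {u : EuclideanSpace ℝ ι} (hu : ‖u‖ = 1) :
    IsRealPure (complexify u) :=
  ⟨by rw [norm_complexify, hu], fun i => by simp [complexify]⟩

lemma IsRealPure.exists_complexify {φ : EuclideanSpace ℂ ι} (h : IsRealPure φ) :
    ∃ u : EuclideanSpace ℝ ι, ‖u‖ = 1 ∧ φ = complexify u := by
  have h1 : φ = complexify (WithLp.toLp 2 fun i => (φ i).re) := by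
    ext i
    exact Complex.ext (by simp [complexify]) (by simp [complexify, h.2 i])
  refine ⟨_, ?_, h1⟩
  rw [← norm_complexify, ← h1, h.1]

lemma isCompact_setOf_isRealPure : IsCompact {φ : EuclideanSpace ℂ ι | IsRealPure φ} := by
  have h : {φ : EuclideanSpace ℂ ι | IsRealPure φ}
      = Metric.sphere 0 1 ∩ ⋂ i, {φ : EuclideanSpace ℂ ι | (φ i).im = 0} := by
    ext φ; simp [IsRealPure]
  rw [h]
  refine (isCompact_sphere _ _).inter_right (isClosed_iInter fun i => ?_)
  exact isClosed_eq (by fun_prop) continuous_const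

lemma exists_isRealPure [Nonempty ι] : ∃ φ : EuclideanSpace ℂ ι, IsRealPure φ := by
  classical
  inhabit ι
  exact ⟨_, isRealPure_complexify (u := EuclideanSpace.single default 1) (by simp)⟩

lemma exists_isRealPure_forall_le [Nonempty ι] (ψ : EuclideanSpace ℂ ι) :
    ∃ φ : EuclideanSpace ℂ ι, IsRealPure φ ∧ ‖inner ℂ φ ψ‖ ^ 2 = 1 - geomImagPure ψ ∧
      ∀ φ', IsRealPure φ' → ‖inner ℂ φ' ψ‖ ^ 2 ≤ 1 - geomImagPure ψ := by
  obtain ⟨φ, hφ, hmax⟩ := isCompact_setOf_isRealPure.exists_isMaxOn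
    (exists_isRealPure (ι := ι)) (f := fun φ => ‖inner ℂ φ ψ‖ ^ 2) (by fun_prop)
  have hg : IsGreatest {x : ℝ | ∃ φ : EuclideanSpace ℂ ι, IsRealPure φ ∧ x = ‖inner ℂ φ ψ‖ ^ 2}
      (‖inner ℂ φ ψ‖ ^ 2) := ⟨⟨φ, hφ, rfl⟩, by rintro _ ⟨φ', h', rfl⟩; exact hmax h'⟩
  have he : 1 - geomImagPure ψ = ‖inner ℂ φ ψ‖ ^ 2 := by
    rw [geomImagPure, hg.csSup_eq]; ring
  exact ⟨φ, hφ, he.symm, fun φ' h' => he ▸ hmax h'⟩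

lemma geomImagPure_smul (ψ : EuclideanSpace ℂ ι) {c : ℂ} (hc : ‖c‖ = 1) :
    geomImagPure (c • ψ) = geomImagPure ψ := by
  simp [geomImagPure, hc]

/-- The pure state `cos θ e + i sin θ e'`. -/
noncomputable def canonicalState (e e' : EuclideanSpace ℝ ι) (θ : ℝ) : EuclideanSpace ℂ ι :=
  (Real.cos θ : ℂ) • complexify e + (Complex.I * Real.sin θ) • complexify e'

lemma inner_canonicalState {e e' : EuclideanSpace ℝ ι} (he : ‖e‖ = 1) (he' : ‖e'‖ = 1)
    (hee : inner ℝ e e' = 0) (θ θ' : ℝ) :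
    inner ℂ (canonicalState e e' θ) (canonicalState e e' θ') = (Real.cos (θ - θ') : ℂ) := by
  have hee' : inner ℝ e' e = 0 := by rw [real_inner_comm, hee]
  simp only [canonicalState, inner_add_left, inner_add_right, inner_smul_left, inner_smul_right,
    inner_complexify, real_inner_self_eq_norm_sq, he, he', hee, hee', Real.cos_sub, map_mul,
    Complex.conj_ofReal, Complex.conj_I]
  push_cast
  linear_combination (-Complex.sin θ * Complex.sin θ') * Complex.I_sq

lemma norm_canonicalState {e e' : EuclideanSpace ℝ ι} (he : ‖e‖ = 1) (he' : ‖e'‖ = 1)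
    (hee : inner ℝ e e' = 0) (θ : ℝ) : ‖canonicalState e e' θ‖ = 1 := by
  have h2 : ‖canonicalState e e' θ‖ ^ 2 = 1 := by
    rw [← inner_self_eq_norm_sq (𝕜 := ℂ), inner_canonicalState he he' hee]; simp
  exact (pow_eq_one_iff_of_nonneg (norm_nonneg _) two_ne_zero).1 h2

/-- A real unit vector `u` has squared overlap `cos² θ ⟨u, e⟩² + sin² θ ⟨u, e'⟩²`. By Bessel's
inequality and `sin² θ ≤ cos² θ`, the best choice is `u = e`. -/
lemma geomImagPure_canonicalState {e e' : EuclideanSpace ℝ ι} (he : ‖e‖ = 1) (he' : ‖e'‖ = 1)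
    (hee : inner ℝ e e' = 0) {θ : ℝ} (h0 : 0 ≤ θ) (h1 : θ ≤ Real.pi / 4) :
    geomImagPure (canonicalState e e' θ) = Real.sin θ ^ 2 := by
  have key : ∀ u : EuclideanSpace ℝ ι, ‖inner ℂ (complexify u) (canonicalState e e' θ)‖ ^ 2
      = Real.cos θ ^ 2 * inner ℝ u e ^ 2 + Real.sin θ ^ 2 * inner ℝ u e' ^ 2 := fun u => by
    rw [canonicalState, inner_add_right, inner_smul_right, inner_smul_right, inner_complexify,
      inner_complexify, Complex.sq_norm, Complex.normSq_apply]
    simp [-Complex.ofReal_cos, -Complex.ofReal_sin]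
    ring
  have hsc : Real.sin θ ^ 2 ≤ Real.cos θ ^ 2 := by
    have := Real.cos_nonneg_of_neg_pi_div_two_le_of_le (x := 2 * θ)
      (by linarith [Real.pi_pos]) (by linarith)
    rw [Real.cos_two_mul'] at this
    linarith
  have hg : IsGreatest {x : ℝ | ∃ φ : EuclideanSpace ℂ ι, IsRealPure φ ∧
      x = ‖inner ℂ φ (canonicalState e e' θ)‖ ^ 2} (Real.cos θ ^ 2) := by
    refine ⟨⟨complexify e, isRealPure_complexify he, ?_⟩, ?_⟩
    · rw [key, real_inner_self_eq_norm_sq, he, hee]; ring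
    · rintro _ ⟨φ, hφ, rfl⟩
      obtain ⟨u, hu, rfl⟩ := hφ.exists_complexify
      rw [key]
      have hb : inner ℝ u e ^ 2 + inner ℝ u e' ^ 2 ≤ 1 := by
        have h3 : 0 ≤ inner ℝ (u - inner ℝ u e • e - inner ℝ u e' • e')
          (u - inner ℝ u e • e - inner ℝ u e' • e') := real_inner_self_nonneg
        have hee' : inner ℝ e' e = 0 := by rw [real_inner_comm, hee]
        simp only [inner_sub_left, inner_sub_right, inner_smul_left, inner_smul_right,
          real_inner_self_eq_norm_sq, he, he', hee, hee', hu, real_inner_comm e u,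
          real_inner_comm e' u, conj_trivial] at h3
        rw [real_inner_comm u e, real_inner_comm u e'] at h3
        nlinarith
      nlinarith [sq_nonneg (inner ℝ u e'), sq_nonneg (Real.cos θ)]
  rw [geomImagPure, hg.csSup_eq, Real.sin_sq]

lemma exists_unit_orthogonal (hι : 2 ≤ Fintype.card ι) (e : EuclideanSpace ℝ ι) :
    ∃ e' : EuclideanSpace ℝ ι, ‖e'‖ = 1 ∧ inner ℝ e e' = 0 := by
  have hne : (ℝ ∙ e)ᗮ ≠ ⊥ := fun h => by
    have h1 := (ℝ ∙ e).finrank_add_finrank_orthogonal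
    rw [h, finrank_bot, finrank_euclideanSpace] at h1
    have h2 := finrank_span_le_card (R := ℝ) ({e} : Set (EuclideanSpace ℝ ι))
    rw [Set.toFinset_singleton, Finset.card_singleton] at h2
    omega
  obtain ⟨v, hv, hv0⟩ := Submodule.exists_mem_ne_zero_of_ne_bot hne
  have h1 : inner ℝ e v = 0 := Submodule.mem_orthogonal_singleton_iff_inner_right.1 hv
  exact ⟨‖v‖⁻¹ • v, by rw [norm_smul, norm_inv, norm_norm, inv_mul_cancel₀ (norm_ne_zero_iff.2 hv0)],
    by rw [inner_smul_right, h1, mul_zero]⟩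

/-- Up to a phase, every pure state is of the form `cos θ e + i sin θ e'`. -/
lemma exists_eq_smul_canonicalState (hι : 2 ≤ Fintype.card ι) {ψ : EuclideanSpace ℂ ι}
    (hψ : ‖ψ‖ = 1) :
    ∃ (c : ℂ) (e e' : EuclideanSpace ℝ ι) (θ : ℝ), ‖c‖ = 1 ∧ ‖e‖ = 1 ∧ ‖e'‖ = 1 ∧
      inner ℝ e e' = 0 ∧ 0 ≤ θ ∧ θ ≤ Real.pi / 4 ∧ ψ = c • canonicalState e e' θ := by
  -- The phase `c'` makes `∑ (c' ψ i)²` real and nonnegative: its vanishing imaginary part makes the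
  -- real and imaginary parts `a`, `b` of `c' ψ` orthogonal, and its sign gives `‖b‖ ≤ ‖a‖`, hence
  -- the angle bound `π/4`.
  set t : ℂ := ∑ i, ψ i ^ 2 with ht
  set c : ℂ := Complex.exp (((t.arg / 2 : ℝ) : ℂ) * Complex.I) with hc
  set c' : ℂ := Complex.exp (((-(t.arg / 2) : ℝ) : ℂ) * Complex.I) with hc'
  have hcn : ‖c‖ = 1 := Complex.norm_exp_ofReal_mul_I _
  have hcn' : ‖c'‖ = 1 := Complex.norm_exp_ofReal_mul_I _
  have hcc : c * c' = 1 := by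
    rw [hc, hc', ← Complex.exp_add, ← add_mul]; simp
  have hct : c' ^ 2 * t = (‖t‖ : ℂ) := by
    nth_rewrite 1 [← Complex.norm_mul_exp_arg_mul_I t]
    rw [mul_left_comm, hc', ← Complex.exp_nat_mul, ← Complex.exp_add]
    have : (2 : ℕ) * (((-(t.arg / 2) : ℝ) : ℂ) * Complex.I) + t.arg * Complex.I = 0 := by
      push_cast; ring
    rw [this, Complex.exp_zero, mul_one]
  set a : EuclideanSpace ℝ ι := WithLp.toLp 2 fun i => (c' * ψ i).re with ha
  set b : EuclideanSpace ℝ ι := WithLp.toLp 2 fun i => (c' * ψ i).im with hb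
  have hsum : ∑ i, (c' * ψ i) ^ 2 = (‖t‖ : ℂ) := by
    rw [← hct, ht, Finset.mul_sum]
    exact Finset.sum_congr rfl fun i _ => by ring
  have hn : ‖a‖ ^ 2 + ‖b‖ ^ 2 = 1 := by
    have : ‖c' • ψ‖ ^ 2 = 1 := by rw [norm_smul, hcn', hψ]; norm_num
    rw [EuclideanSpace.norm_sq_eq] at this
    rw [EuclideanSpace.norm_sq_eq, EuclideanSpace.norm_sq_eq, ← Finset.sum_add_distrib, ← this]
    refine Finset.sum_congr rfl fun i _ => ?_
    rw [Complex.sq_norm, Complex.normSq_apply]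
    simp [ha, hb]
    ring
  have hd : ‖a‖ ^ 2 - ‖b‖ ^ 2 = ‖t‖ := by
    have := congrArg Complex.re hsum
    rw [Complex.re_sum, Complex.ofReal_re] at this
    rw [EuclideanSpace.norm_sq_eq, EuclideanSpace.norm_sq_eq, ← Finset.sum_sub_distrib, ← this]
    refine Finset.sum_congr rfl fun i _ => ?_
    simp [ha, hb, sq]
  have hab : inner ℝ a b = 0 := by
    have := congrArg Complex.im hsum
    rw [Complex.im_sum, Complex.ofReal_im] at this
    have h2 : 2 * inner ℝ a b = 0 := by
      rw [← this, PiLp.inner_apply, Finset.mul_sum]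
      refine Finset.sum_congr rfl fun i _ => ?_
      simp [ha, hb, sq]
      ring
    linarith
  have hψab : ψ = c • (complexify a + Complex.I • complexify b) := by
    ext i
    have : ψ i = c * (c' * ψ i) := by rw [← mul_assoc, hcc, one_mul]
    rw [this]
    simp only [PiLp.smul_apply, PiLp.add_apply, complexify, ha, hb, smul_eq_mul]
    rw [mul_comm Complex.I, Complex.re_add_im]
  have ha2 : 1 / 2 ≤ ‖a‖ ^ 2 := by nlinarith [norm_nonneg t]
  have ha1 : ‖a‖ ≤ 1 := by nlinarith [sq_nonneg ‖b‖, norm_nonneg a]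
  have ha0 : ‖a‖ ≠ 0 := fun h => by rw [h] at ha2; norm_num at ha2
  have hcos : Real.cos (Real.arccos ‖a‖) = ‖a‖ :=
    Real.cos_arccos (by linarith [norm_nonneg a]) ha1
  have hsin : Real.sin (Real.arccos ‖a‖) = ‖b‖ := by
    rw [Real.sin_arccos, show 1 - ‖a‖ ^ 2 = ‖b‖ ^ 2 by linarith, Real.sqrt_sq (norm_nonneg b)]
  have hpi : Real.arccos ‖a‖ ≤ Real.pi / 4 := by
    rw [Real.arccos_le_pi_div_four]
    have h2 : √2 ^ 2 = 2 := Real.sq_sqrt (by norm_num)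
    exact abs_le_of_sq_le_sq' (by nlinarith) (norm_nonneg a) |>.2
  obtain ⟨e', he', hee, hbe⟩ : ∃ e' : EuclideanSpace ℝ ι, ‖e'‖ = 1 ∧
      inner ℝ (‖a‖⁻¹ • a) e' = 0 ∧ b = ‖b‖ • e' := by
    -- If `b = 0` then `sin θ = 0` and any unit vector orthogonal to `a` serves; this is where
    -- dimension two is needed.
    by_cases hb0 : b = 0
    · obtain ⟨e', h1, h2⟩ := exists_unit_orthogonal hι (‖a‖⁻¹ • a)
      exact ⟨e', h1, h2, by simp [hb0]⟩
    · have hb0' := norm_ne_zero_iff.2 hb0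
      refine ⟨‖b‖⁻¹ • b, ?_, ?_, ?_⟩
      · rw [norm_smul, norm_inv, norm_norm, inv_mul_cancel₀ hb0']
      · rw [inner_smul_left, inner_smul_right, hab]; simp
      · rw [smul_smul, mul_inv_cancel₀ hb0', one_smul]
  refine ⟨c, ‖a‖⁻¹ • a, e', Real.arccos ‖a‖, hcn, ?_, he', hee, Real.arccos_nonneg _, hpi, ?_⟩
  · rw [norm_smul, norm_inv, norm_norm, inv_mul_cancel₀ ha0]
  · rw [hψab, canonicalState, hcos, hsin, ← complexify_smul, smul_smul, mul_inv_cancel₀ ha0,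
      one_smul, mul_smul, ← complexify_smul, ← hbe]

end Pure

/-! ### Geometric imaginarity as a maximal overlap with real matrices -/

section Mixed

variable {ι κ : Type*} [Fintype ι] [Fintype κ]

lemma geomImagPure_nonneg [Nonempty ι] {ψ : EuclideanSpace ℂ ι} (hψ : ‖ψ‖ = 1) :
    0 ≤ geomImagPure ψ := by
  obtain ⟨φ, hφ, h, -⟩ := exists_isRealPure_forall_le ψ
  have h1 : ‖inner ℂ φ ψ‖ ≤ 1 := by simpa [hφ.1, hψ] using norm_inner_le_norm (𝕜 := ℂ) φ ψ
  nlinarith [norm_nonneg (inner ℂ φ ψ)]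

/-- Some basis vector overlaps `ψ`. Strictness makes `S` positive in
`exists_overlap_of_isPureDecomposition`. -/
lemma geomImagPure_lt_one [Nonempty ι] {ψ : EuclideanSpace ℂ ι} (hψ : ‖ψ‖ = 1) :
    geomImagPure ψ < 1 := by
  classical
  obtain ⟨-, -, -, h⟩ := exists_isRealPure_forall_le ψ
  by_contra! h1
  have h2 : ψ = 0 := by
    ext i
    have h3 := h _ (isRealPure_complexify (u := EuclideanSpace.single i 1) (by simp))
    have h4 : inner ℂ (complexify (EuclideanSpace.single i 1)) ψ = ψ i := by
      rw [PiLp.inner_apply, Finset.sum_eq_single i] <;> simp +contextual [complexify]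
    rw [h4] at h3
    have h5 : ‖ψ i‖ ^ 2 = 0 := le_antisymm (by linarith) (sq_nonneg _)
    simpa using h5
  simp [h2] at hψ

/-- Decompositions may be indexed by any finite type. -/
lemma exists_isPureDecomposition_of_fintype {ρ : Matrix ι ι ℂ} {p : κ → ℝ}
    {ψ : κ → EuclideanSpace ℂ ι} (hp : ∀ j, 0 ≤ p j) (hp1 : ∑ j, p j = 1) (hψ : ∀ j, ‖ψ j‖ = 1)
    (hρ : ρ = ∑ j, (p j : ℂ) • ketBra (ψ j)) :
    ∃ (k : ℕ) (q : Fin k → ℝ) (χ : Fin k → EuclideanSpace ℂ ι), IsPureDecomposition ρ q χ ∧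
      ∑ j, p j * geomImagPure (ψ j) = ∑ j, q j * geomImagPure (χ j) := by
  let e := (Fintype.equivFin κ).symm
  refine ⟨Fintype.card κ, p ∘ e, ψ ∘ e, ⟨fun j => hp _, ?_, fun j => hψ _, ?_⟩, ?_⟩
  · rw [← hp1]; exact e.sum_comp p
  · rw [hρ]; exact (e.sum_comp fun j => (p j : ℂ) • ketBra (ψ j)).symm
  · exact (e.sum_comp fun j => p j * geomImagPure (ψ j)).symm

lemma geomImag_le_sum [Nonempty ι] {ρ : Matrix ι ι ℂ} {k : ℕ} {p : Fin k → ℝ}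
    {ψ : Fin k → EuclideanSpace ℂ ι} (h : IsPureDecomposition ρ p ψ) :
    geomImag ρ ≤ ∑ j, p j * geomImagPure (ψ j) := by
  refine csInf_le ⟨0, ?_⟩ ⟨k, p, ψ, h, rfl⟩
  rintro _ ⟨k, q, χ, ⟨hq, -, hχ, -⟩, rfl⟩
  exact Finset.sum_nonneg fun j _ => mul_nonneg (hq j) (geomImagPure_nonneg (hχ j))

/-- The columns of a matrix, as vectors. -/
noncomputable def colVec (A : Matrix ι κ ℂ) (j : κ) : EuclideanSpace ℂ ι :=
  WithLp.toLp 2 fun i => A i j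

lemma inner_hsVec_eq_sum (A B : Matrix ι κ ℂ) :
    inner ℂ (hsVec A) (hsVec B) = ∑ j, inner ℂ (colVec A j) (colVec B j) := by
  rw [PiLp.inner_apply, Fintype.sum_prod_type, Finset.sum_comm]
  simp [PiLp.inner_apply, hsVec, colVec]

lemma norm_hsVec_sq_eq_sum (A : Matrix ι κ ℂ) : ‖hsVec A‖ ^ 2 = ∑ j, ‖colVec A j‖ ^ 2 := by
  rw [← inner_self_eq_norm_sq (𝕜 := ℂ), inner_hsVec_eq_sum, map_sum]
  simp only [inner_self_eq_norm_sq]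

lemma mul_conjTranspose_eq_sum {α : Type*} (A : Matrix α κ ℂ) : A * Aᴴ = ∑ j, ketBra (colVec A j) := by
  ext i l
  simp [mul_apply, Matrix.sum_apply, ketBra, colVec]

lemma ketBra_smul {α : Type*} (c : ℂ) (v : EuclideanSpace ℂ α) :
    ketBra (c • v) = ((‖c‖ ^ 2 : ℝ) : ℂ) • ketBra v := by
  ext i l
  have := Complex.mul_conj' c
  simp only [ketBra, of_apply, PiLp.smul_apply, smul_eq_mul, map_mul, Matrix.smul_apply]
  push_cast
  rw [← this]; ring

/-- A matrix with real entries. -/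
def IsRealMatrix (B : Matrix ι κ ℂ) : Prop := ∀ i j, (B i j).im = 0

/-- A zero column has weight zero, so any real pure state may stand for its direction. -/
lemma exists_eq_norm_smul [Nonempty ι] (v : EuclideanSpace ℂ ι) :
    ∃ u : EuclideanSpace ℂ ι, ‖u‖ = 1 ∧ v = (‖v‖ : ℂ) • u ∧
      ((∀ i, (v i).im = 0) → IsRealPure u) := by
  by_cases hv : v = 0
  · obtain ⟨φ, hφ⟩ := exists_isRealPure (ι := ι)
    exact ⟨φ, hφ.1, by simp [hv], fun _ => hφ⟩
  · have hv' : ‖v‖ ≠ 0 := norm_ne_zero_iff.2 hv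
    have hu : ‖((‖v‖⁻¹ : ℝ) : ℂ) • v‖ = 1 := by
      rw [norm_smul, Complex.norm_real, norm_inv, norm_norm, inv_mul_cancel₀ hv']
    refine ⟨((‖v‖⁻¹ : ℝ) : ℂ) • v, hu, ?_, fun h => ⟨hu, fun i => ?_⟩⟩
    · rw [smul_smul, ← Complex.ofReal_mul, mul_inv_cancel₀ hv', Complex.ofReal_one, one_smul]
    · rw [PiLp.smul_apply, smul_eq_mul, Complex.im_ofReal_mul, h i, mul_zero]

lemma exists_normalized_columns [Nonempty ι] {A : Matrix ι κ ℂ} (hA : (A * Aᴴ).trace = 1) :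
    ∃ ψ : κ → EuclideanSpace ℂ ι, (∀ j, ‖ψ j‖ = 1) ∧ (∀ j, colVec A j = (‖colVec A j‖ : ℂ) • ψ j) ∧
      ∑ j, ‖colVec A j‖ ^ 2 = 1 ∧
      A * Aᴴ = ∑ j, ((‖colVec A j‖ ^ 2 : ℝ) : ℂ) • ketBra (ψ j) := by
  choose ψ hψ1 hψ hψ' using fun j => exists_eq_norm_smul (colVec A j)
  refine ⟨ψ, hψ1, hψ, by rw [← norm_hsVec_sq_eq_sum, norm_hsVec_eq_one hA, one_pow], ?_⟩
  rw [mul_conjTranspose_eq_sum]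
  refine Finset.sum_congr rfl fun j _ => ?_
  nth_rewrite 1 [hψ j]
  rw [ketBra_smul, Complex.norm_real, norm_norm]

lemma IsState.nonempty {ρ : Matrix ι ι ℂ} (hρ : IsState ρ) : Nonempty ι := by
  by_contra h
  rw [not_nonempty_iff] at h
  simpa [trace] using hρ.2

lemma IsState.exists_isPureDecomposition {ρ : Matrix ι ι ℂ} (hρ : IsState ρ) :
    ∃ (k : ℕ) (p : Fin k → ℝ) (ψ : Fin k → EuclideanSpace ℂ ι), IsPureDecomposition ρ p ψ := by
  classical
  have := hρ.nonempty
  have hs : CFC.sqrt ρ * (CFC.sqrt ρ)ᴴ = ρ := by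
    rw [conjTranspose_sqrt, sqrt_mul_sqrt_of_posSemidef hρ.1]
  obtain ⟨ψ, hψ, -, hp, h⟩ := exists_normalized_columns (A := CFC.sqrt ρ) (by rw [hs, hρ.2])
  obtain ⟨k, q, χ, h', -⟩ :=
    exists_isPureDecomposition_of_fintype (fun j => sq_nonneg _) hp hψ (hs ▸ h)
  exact ⟨k, q, χ, h'⟩

/-- Overlaps of purifications with real matrices bound the geometric imaginarity from above. -/
lemma geomImag_mul_conjTranspose_le [Nonempty ι] {A B : Matrix ι κ ℂ}
    (hA : (A * Aᴴ).trace = 1) (hB : IsRealMatrix B) (hB1 : ‖hsVec B‖ = 1) :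
    geomImag (A * Aᴴ) ≤ 1 - ‖inner ℂ (hsVec B) (hsVec A)‖ ^ 2 := by
  obtain ⟨ψ, hψ1, hψ, hp1, hd⟩ := exists_normalized_columns hA
  choose φ hφ1 hφ hφ' using fun j => exists_eq_norm_smul (colVec B j)
  obtain ⟨k, q, χ, hq, hsum⟩ :=
    exists_isPureDecomposition_of_fintype (fun j => sq_nonneg _) hp1 hψ1 hd
  have h1 := geomImag_le_sum hq
  rw [← hsum] at h1
  have h2 : ‖inner ℂ (hsVec B) (hsVec A)‖
      ≤ ∑ j, ‖colVec B j‖ * (‖colVec A j‖ * ‖inner ℂ (φ j) (ψ j)‖) := by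
    rw [inner_hsVec_eq_sum]
    refine (norm_sum_le _ _).trans (Finset.sum_le_sum fun j _ => le_of_eq ?_)
    nth_rewrite 1 [hψ j, hφ j]
    rw [inner_smul_left, inner_smul_right, norm_mul, norm_mul, RCLike.norm_conj, Complex.norm_real,
      Complex.norm_real, norm_norm, norm_norm]
  -- Cauchy–Schwarz against the column norms of `B`, whose squares sum to one.
  have h3 := Finset.sum_mul_sq_le_sq_mul_sq Finset.univ (fun j => ‖colVec B j‖)
    (fun j => ‖colVec A j‖ * ‖inner ℂ (φ j) (ψ j)‖)
  rw [← norm_hsVec_sq_eq_sum, hB1, one_pow, one_mul] at h3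
  have h4 : ∑ j, (‖colVec A j‖ * ‖inner ℂ (φ j) (ψ j)‖) ^ 2
      ≤ ∑ j, ‖colVec A j‖ ^ 2 * (1 - geomImagPure (ψ j)) := by
    refine Finset.sum_le_sum fun j _ => ?_
    rw [mul_pow]
    obtain ⟨-, -, -, h⟩ := exists_isRealPure_forall_le (ψ j)
    exact mul_le_mul_of_nonneg_left (h _ (hφ' j fun i => hB i j)) (sq_nonneg _)
  simp only [mul_sub, mul_one, Finset.sum_sub_distrib, hp1] at h4
  have h5 := pow_le_pow_left₀ (norm_nonneg _) h2 2
  linarith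

/-- Every decomposition is realised by the overlap of a purification with a real matrix. -/
lemma exists_overlap_of_isPureDecomposition [Nonempty ι] {ρ : Matrix ι ι ℂ} {k : ℕ}
    {p : Fin k → ℝ} {ψ : Fin k → EuclideanSpace ℂ ι} (h : IsPureDecomposition ρ p ψ) :
    ∃ A B : Matrix ι (Fin k) ℂ, A * Aᴴ = ρ ∧ IsRealMatrix B ∧ ‖hsVec B‖ = 1 ∧
      ‖inner ℂ (hsVec B) (hsVec A)‖ ^ 2 = 1 - ∑ j, p j * geomImagPure (ψ j) := by
  obtain ⟨hp, hp1, hψ, hρ⟩ := h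
  choose φ hφ hn hmax using fun j => exists_isRealPure_forall_le (ψ j)
  choose c hc hcn using fun j => RCLike.exists_norm_eq_mul_self (inner ℂ (φ j) (ψ j))
  set S := 1 - ∑ j, p j * geomImagPure (ψ j) with hS
  have hS' : S = ∑ j, p j * ‖inner ℂ (φ j) (ψ j)‖ ^ 2 := by
    simp only [hn, mul_sub, mul_one, Finset.sum_sub_distrib, hp1, hS]
  have hS0 : 0 < S := by
    obtain ⟨j, -, hj⟩ : ∃ j ∈ Finset.univ, 0 < p j := by
      by_contra! hcon
      have := Finset.sum_nonpos hcon
      linarith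
    rw [hS']
    refine Finset.sum_pos' (fun j _ => mul_nonneg (hp j) (sq_nonneg _)) ⟨j, Finset.mem_univ _, ?_⟩
    rw [hn]
    exact mul_pos hj (by linarith [geomImagPure_lt_one (hψ j)])
  have hsS : √S ^ 2 = S := Real.sq_sqrt hS0.le
  have hsS0 : √S ≠ 0 := (Real.sqrt_pos.2 hS0).ne'
  -- The phases `c j` make all column overlaps nonnegative, and the weights `b j` are those of
  -- equality in Cauchy–Schwarz, normalised by `√S`.
  let a : Fin k → ℂ := fun j => (√(p j) : ℂ) * c j
  let b : Fin k → ℝ := fun j => √(p j) * ‖inner ℂ (φ j) (ψ j)‖ / √S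
  let A : Matrix ι (Fin k) ℂ := of fun i j => (a j • ψ j) i
  let B : Matrix ι (Fin k) ℂ := of fun i j => ((b j : ℂ) • φ j) i
  have hA : ∀ j, colVec A j = a j • ψ j := fun j => rfl
  have hB : ∀ j, colVec B j = (b j : ℂ) • φ j := fun j => rfl
  have hsp : ∀ j, √(p j) ^ 2 = p j := fun j => Real.sq_sqrt (hp j)
  refine ⟨A, B, ?_, ?_, ?_, ?_⟩
  · rw [mul_conjTranspose_eq_sum, hρ]
    refine Finset.sum_congr rfl fun j _ => ?_
    rw [hA, ketBra_smul]
    simp [a, hc, hsp]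
  · intro i j
    simp [B, (hφ j).2 i]
  · have h2 : ‖hsVec B‖ ^ 2 = 1 := by
      rw [norm_hsVec_sq_eq_sum]
      have h3 : ∀ j, ‖colVec B j‖ ^ 2 = p j * ‖inner ℂ (φ j) (ψ j)‖ ^ 2 / S := fun j => by
        rw [hB, norm_smul, (hφ j).1, mul_one, Complex.norm_real, Real.norm_eq_abs, sq_abs, div_pow,
          mul_pow, hsp, hsS]
      rw [Finset.sum_congr rfl fun j _ => h3 j, ← Finset.sum_div, ← hS', div_self hS0.ne']
    exact (pow_eq_one_iff_of_nonneg (norm_nonneg _) two_ne_zero).1 h2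
  · have h2 : inner ℂ (hsVec B) (hsVec A) = (√S : ℂ) := by
      rw [inner_hsVec_eq_sum]
      have h3 : ∀ j, inner ℂ (colVec B j) (colVec A j)
          = ((p j * ‖inner ℂ (φ j) (ψ j)‖ ^ 2 / √S : ℝ) : ℂ) := fun j => by
        have h4 : a j * inner ℂ (φ j) (ψ j) = ((√(p j) * ‖inner ℂ (φ j) (ψ j)‖ : ℝ) : ℂ) := by
          have h5 : ((‖inner ℂ (φ j) (ψ j)‖ : ℝ) : ℂ) = c j * inner ℂ (φ j) (ψ j) := hcn j
          rw [Complex.ofReal_mul, h5]; simp only [a]; ring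
        rw [hB, hA, inner_smul_left, inner_smul_right, h4, Complex.conj_ofReal,
          ← Complex.ofReal_mul]
        congr 1
        simp only [b]
        field_simp
        rw [hsp, mul_comm]
      rw [Finset.sum_congr rfl fun j _ => h3 j, ← Complex.ofReal_sum, ← Finset.sum_div, ← hS']
      congr 1
      rw [div_eq_iff hsS0, ← sq, hsS]
    rw [h2, Complex.norm_real, Real.norm_eq_abs, sq_abs, hsS]

lemma map_ofReal_mul_conjTranspose {α : Type*} (M : Matrix α κ ℝ) :
    M.map ((↑) : ℝ → ℂ) * (M.map ((↑) : ℝ → ℂ))ᴴ = (M * Mᴴ).map ((↑) : ℝ → ℂ) := by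
  ext i j
  simp [mul_apply]

/-- A real matrix may be replaced by a square real matrix with the same Gram matrix. -/
lemma IsRealMatrix.exists_square {B : Matrix ι κ ℂ} (hB : IsRealMatrix B) :
    ∃ B₀ : Matrix ι ι ℂ, IsRealMatrix B₀ ∧ B₀ * B₀ᴴ = B * Bᴴ := by
  classical
  set C : Matrix ι κ ℝ := of fun i j => (B i j).re with hC
  have hBC : B = C.map ((↑) : ℝ → ℂ) := by
    ext i j
    exact Complex.ext (by simp [hC]) (by simp [hB i j])
  have hpos : (C * Cᴴ).PosSemidef := posSemidef_self_mul_conjTranspose C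
  -- The square root is taken over `ℝ`, so it is real.
  set S := CFC.sqrt (C * Cᴴ) with hS
  have hSS : S * S = C * Cᴴ := CFC.sqrt_mul_sqrt_self _ (nonneg_iff_posSemidef.2 hpos)
  have hSh : Sᴴ = S := (nonneg_iff_posSemidef.1 (CFC.sqrt_nonneg _)).isHermitian
  refine ⟨S.map ((↑) : ℝ → ℂ), fun i j => by simp, ?_⟩
  rw [map_ofReal_mul_conjTranspose, hSh, hSS, ← map_ofReal_mul_conjTranspose, ← hBC]

/-- Maximal overlaps of purifications of `ρ` with normalised real matrices exist. -/
lemma exists_max_overlap [DecidableEq ι] {ρ : Matrix ι ι ℂ} (hρ : IsState ρ) :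
    ∃ A B : Matrix ι ι ℂ, A * Aᴴ = ρ ∧ IsRealMatrix B ∧ ‖hsVec B‖ = 1 ∧
      ∀ A' B' : Matrix ι ι ℂ, A' * A'ᴴ = ρ → IsRealMatrix B' → ‖hsVec B'‖ = 1 →
        ‖inner ℂ (hsVec B') (hsVec A')‖ ≤ ‖inner ℂ (hsVec B) (hsVec A)‖ := by
  have := hρ.nonempty
  let un : EuclideanSpace ℂ (ι × ι) → Matrix ι ι ℂ := fun x => of fun i j => x (i, j)
  have hun : ∀ M, un (hsVec M) = M := fun M => rfl
  have hcont : Continuous un := continuous_matrix fun i j => by simp only [un, of_apply]; fun_prop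
  -- Both sphere conditions hold automatically for the pairs of interest, since `tr ρ = 1`; they
  -- make `K` bounded.
  let K : Set (EuclideanSpace ℂ (ι × ι) × EuclideanSpace ℂ (ι × ι)) :=
    (Metric.sphere 0 1 ×ˢ Metric.sphere 0 1) ∩
      ({x | un x.1 * (un x.1)ᴴ = ρ} ∩ ⋂ i, ⋂ j, {x | (un x.2 i j).im = 0})
  have hK : IsCompact K := by
    refine ((isCompact_sphere _ _).prod (isCompact_sphere _ _)).inter_right
      (IsClosed.inter ?_ (isClosed_iInter fun i => isClosed_iInter fun j => ?_))
    · exact isClosed_eq (by fun_prop) continuous_const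
    · exact isClosed_eq (by simp only [un, of_apply]; fun_prop) continuous_const
  have hmem : ∀ A B : Matrix ι ι ℂ, A * Aᴴ = ρ → IsRealMatrix B → ‖hsVec B‖ = 1 →
      (hsVec A, hsVec B) ∈ K := fun A B hA hB hB1 => by
    refine ⟨⟨?_, ?_⟩, hA, ?_⟩
    · simpa using norm_hsVec_eq_one (by rw [hA, hρ.2])
    · simpa using hB1
    · simpa [hun, IsRealMatrix] using hB
  have hKne : K.Nonempty := by
    inhabit ι
    refine ⟨_, hmem (CFC.sqrt ρ) (single default default 1) ?_ ?_ ?_⟩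
    · rw [conjTranspose_sqrt, sqrt_mul_sqrt_of_posSemidef hρ.1]
    · intro i j
      rw [single_apply]
      split_ifs <;> simp
    · exact norm_hsVec_eq_one (by simp)
  obtain ⟨⟨x, y⟩, ⟨⟨-, hy⟩, hx, hyr⟩, hmax⟩ := hK.exists_isMaxOn hKne
    (f := fun z => ‖inner ℂ z.2 z.1‖) (by fun_prop)
  refine ⟨un x, un y, hx, by simpa [IsRealMatrix] using hyr,
    (by simpa using hy : ‖y‖ = 1),
    fun A' B' hA' hB' hB1' => hmax (hmem A' B' hA' hB' hB1')⟩

/-- The geometric imaginarity is `sin² θ`, where `cos θ` is the largest overlap of a purification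
of `ρ` with a normalised real matrix. -/
lemma exists_angle [DecidableEq ι] {ρ : Matrix ι ι ℂ} (hρ : IsState ρ) :
    ∃ θ : ℝ, 0 ≤ θ ∧ θ ≤ Real.pi / 2 ∧ geomImag ρ = Real.sin θ ^ 2 ∧
      (∃ A B : Matrix ι ι ℂ, A * Aᴴ = ρ ∧ IsRealMatrix B ∧ ‖hsVec B‖ = 1 ∧
        inner ℂ (hsVec B) (hsVec A) = (Real.cos θ : ℂ)) ∧
      ∀ A B : Matrix ι ι ℂ, A * Aᴴ = ρ → IsRealMatrix B → ‖hsVec B‖ = 1 →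
        θ ≤ Real.arccos ‖inner ℂ (hsVec B) (hsVec A)‖ := by
  have := hρ.nonempty
  obtain ⟨A, B, hA, hB, hB1, hmax⟩ := exists_max_overlap hρ
  set m := ‖inner ℂ (hsVec B) (hsVec A)‖ with hm
  have hm0 : 0 ≤ m := norm_nonneg _
  have hm1 : m ≤ 1 := by
    simpa [hB1, norm_hsVec_eq_one (A := A) (by rw [hA, hρ.2])] using
      norm_inner_le_norm (𝕜 := ℂ) (hsVec B) (hsVec A)
  have hcos : Real.cos (Real.arccos m) = m := Real.cos_arccos (by linarith) hm1
  refine ⟨Real.arccos m, Real.arccos_nonneg _, Real.arccos_le_pi_div_two.2 hm0, ?_, ?_, ?_⟩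
  · rw [Real.sin_sq, hcos]
    apply le_antisymm
    · rw [← hA]
      exact geomImag_mul_conjTranspose_le (by rw [hA, hρ.2]) hB hB1
    · refine le_csInf ?_ ?_
      · obtain ⟨k, p, ψ, h⟩ := hρ.exists_isPureDecomposition
        exact ⟨_, k, p, ψ, h, rfl⟩
      · rintro _ ⟨k, p, ψ, h, rfl⟩
        obtain ⟨A', B', hA', hB', hB1', h'⟩ := exists_overlap_of_isPureDecomposition h
        -- The decomposition has arbitrary length `k`, while `m` is a maximum over square matrices.
        -- The fidelity depends only on the Gram matrices, so Uhlmann's theorem passes to a square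
        -- pair with at least the same overlap.
        obtain ⟨B₀, hB₀, hBB⟩ := hB'.exists_square
        obtain ⟨A₀, hA₀, hin⟩ := exists_purification_inner_eq hρ.1 B₀
        have hB₀1 : ‖hsVec B₀‖ = 1 := by
          have := norm_hsVec_sq B₀
          rw [hBB, ← norm_hsVec_sq, hB1', one_pow] at this
          exact (pow_eq_one_iff_of_nonneg (norm_nonneg _) two_ne_zero).1 this
        have h1 := norm_inner_hsVec_le A' B'
        have h2 := hmax A₀ B₀ hA₀ hB₀ hB₀1
        rw [norm_inner_symm, hin, hBB, Complex.norm_real, Real.norm_eq_abs,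
          abs_of_nonneg (rootFidelity_nonneg _ _)] at h2
        rw [hA', norm_inner_symm] at h1
        have h3 := pow_le_pow_left₀ (norm_nonneg _) (h1.trans h2) 2
        linarith
  · obtain ⟨c, hc, hcm⟩ := RCLike.exists_norm_eq_mul_self (inner ℂ (hsVec B) (hsVec A))
    refine ⟨c • A, B, ?_, hB, hB1, ?_⟩
    · have h1 : c * star c = 1 := by
        rw [Complex.star_def, Complex.mul_conj', hc]; simp
      rw [conjTranspose_smul, smul_mul_smul_comm, h1, one_smul, hA]
    · have : hsVec (c • A) = c • hsVec A := rfl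
      rw [this, inner_smul_right, hcos]
      exact hcm.symm
  · intro A' B' hA' hB' hB1'
    exact Real.arccos_le_arccos (hmax A' B' hA' hB' hB1')

end Mixed

/-! ### The bound `1/2`, and consistency on pure states -/

section PureStates

variable {ι : Type*} [Fintype ι]

lemma geomImagPure_le_half (hι : 2 ≤ Fintype.card ι) {ψ : EuclideanSpace ℂ ι} (hψ : ‖ψ‖ = 1) :
    geomImagPure ψ ≤ 1 / 2 := by
  obtain ⟨c, e, e', θ, hc, he, he', hee, h0, h1, rfl⟩ := exists_eq_smul_canonicalState hι hψ
  rw [geomImagPure_smul _ hc, geomImagPure_canonicalState he he' hee h0 h1]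
  have h2 := Real.sin_le_sin_of_le_of_le_pi_div_two (by linarith [Real.pi_pos])
    (by linarith [Real.pi_pos]) h1
  have h3 := Real.sin_nonneg_of_nonneg_of_le_pi h0 (by linarith [Real.pi_pos])
  have h4 := pow_le_pow_left₀ h3 h2 2
  rw [Real.sin_pi_div_four, div_pow, Real.sq_sqrt (by norm_num)] at h4
  linarith

lemma geomImag_le_half (hι : 2 ≤ Fintype.card ι) {ρ : Matrix ι ι ℂ} (hρ : IsState ρ) :
    geomImag ρ ≤ 1 / 2 := by
  have := hρ.nonempty
  obtain ⟨k, p, ψ, h⟩ := hρ.exists_isPureDecomposition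
  refine (geomImag_le_sum h).trans ?_
  obtain ⟨hp, hp1, hψ, -⟩ := h
  calc ∑ j, p j * geomImagPure (ψ j) ≤ ∑ j, p j * (1 / 2) :=
        Finset.sum_le_sum fun j _ =>
          mul_le_mul_of_nonneg_left (geomImagPure_le_half hι (hψ j)) (hp j)
    _ = 1 / 2 := by rw [← Finset.sum_mul, hp1, one_mul]

/-- A vector as a one-column matrix. -/
noncomputable def colMatrix (ψ : EuclideanSpace ℂ ι) : Matrix ι Unit ℂ := of fun i _ => ψ i

lemma colMatrix_mul_conjTranspose {α : Type*} (ψ : EuclideanSpace ℂ α) :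
    colMatrix ψ * (colMatrix ψ)ᴴ = ketBra ψ := by
  ext i j
  simp [colMatrix, ketBra, mul_apply]

lemma inner_hsVec_colMatrix (ψ χ : EuclideanSpace ℂ ι) :
    inner ℂ (hsVec (colMatrix ψ)) (hsVec (colMatrix χ)) = inner ℂ ψ χ := by
  rw [inner_hsVec_eq_sum, Fintype.sum_unique]
  rfl

lemma isState_of_norm_hsVec_eq_one {κ : Type*} [Fintype κ] {A : Matrix ι κ ℂ}
    (hA : ‖hsVec A‖ = 1) : IsState (A * Aᴴ) := by
  refine ⟨posSemidef_self_mul_conjTranspose A, ?_⟩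
  rw [trace_mul_comm, ← inner_hsVec, inner_self_eq_norm_sq_to_K, hA]
  simp

lemma isState_ketBra {ψ : EuclideanSpace ℂ ι} (hψ : ‖ψ‖ = 1) : IsState (ketBra ψ) := by
  rw [← colMatrix_mul_conjTranspose]
  refine isState_of_norm_hsVec_eq_one ?_
  have h := norm_hsVec_sq_eq_sum (colMatrix ψ)
  rw [Fintype.sum_unique] at h
  have h2 : ‖hsVec (colMatrix ψ)‖ ^ 2 = 1 := by
    rw [h, show colVec (colMatrix ψ) _ = ψ from rfl, hψ, one_pow]
  exact (pow_eq_one_iff_of_nonneg (norm_nonneg _) two_ne_zero).1 h2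

lemma star_dotProduct_ketBra_mulVec (ψ χ : EuclideanSpace ℂ ι) :
    star (ψ : ι → ℂ) ⬝ᵥ (ketBra χ *ᵥ ψ) = ((‖inner ℂ ψ χ‖ ^ 2 : ℝ) : ℂ) := by
  have h : ketBra χ = vecMulVec χ (star χ) := by
    ext i j; simp [ketBra, vecMulVec_apply]
  have h2 : star (χ : ι → ℂ) ⬝ᵥ ψ = inner ℂ χ ψ := by
    rw [EuclideanSpace.inner_eq_star_dotProduct, dotProduct_comm]
  have h3 : star (ψ : ι → ℂ) ⬝ᵥ χ = inner ℂ ψ χ := by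
    rw [EuclideanSpace.inner_eq_star_dotProduct, dotProduct_comm]
  rw [h, vecMulVec_mulVec, h2, dotProduct_smul, h3, ← inner_conj_symm χ ψ, op_smul_eq_mul, Complex.mul_conj']
  push_cast; rfl

/-- The two notions of geometric imaginarity agree on pure states. -/
lemma geomImag_ketBra {ψ : EuclideanSpace ℂ ι} (hψ : ‖ψ‖ = 1) :
    geomImag (ketBra ψ) = geomImagPure ψ := by
  have hset : {x : ℝ | ∃ (k : ℕ) (p : Fin k → ℝ) (χ : Fin k → EuclideanSpace ℂ ι),
      IsPureDecomposition (ketBra ψ) p χ ∧ x = ∑ j, p j * geomImagPure (χ j)}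
      = {geomImagPure ψ} := by
    refine Set.eq_singleton_iff_unique_mem.2 ⟨⟨1, fun _ => 1, fun _ => ψ,
      ⟨fun _ => zero_le_one, by simp, fun _ => hψ, by simp⟩, by simp⟩, ?_⟩
    rintro _ ⟨k, p, χ, ⟨hp, hp1, hχ, h⟩, rfl⟩
    -- Taking the expectation in `ψ` forces every `χ j` of positive weight to equal `ψ` up to phase.
    have h1 : ∑ j, p j * ‖inner ℂ ψ (χ j)‖ ^ 2 = 1 := by
      have h2 := congrArg (fun M : Matrix ι ι ℂ => star (ψ : ι → ℂ) ⬝ᵥ (M *ᵥ ψ)) h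
      simp only [sum_mulVec, smul_mulVec, dotProduct_sum, dotProduct_smul,
        star_dotProduct_ketBra_mulVec, smul_eq_mul] at h2
      rw [inner_self_eq_norm_sq_to_K, hψ] at h2
      simp only [← Complex.ofReal_mul, ← Complex.ofReal_sum] at h2
      have h3 := Complex.ofReal_injective h2
      rw [← h3]; simp
    have hle : ∀ j, ‖inner ℂ ψ (χ j)‖ ≤ 1 := fun j => by
      simpa [hψ, hχ j] using norm_inner_le_norm (𝕜 := ℂ) ψ (χ j)
    have h2 : ∑ j, p j * (1 - ‖inner ℂ ψ (χ j)‖ ^ 2) = 0 := by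
      simp only [mul_sub, mul_one, Finset.sum_sub_distrib, hp1, h1, sub_self]
    rw [Finset.sum_eq_zero_iff_of_nonneg fun j _ => mul_nonneg (hp j)
      (by nlinarith [hle j, norm_nonneg (inner ℂ ψ (χ j))])] at h2
    have h3 : ∀ j, p j * geomImagPure (χ j) = p j * geomImagPure ψ := fun j => by
      rcases mul_eq_zero.1 (h2 j (Finset.mem_univ j)) with h4 | h4
      · rw [h4, zero_mul, zero_mul]
      · have h5 : ‖inner ℂ ψ (χ j)‖ = ‖ψ‖ * ‖χ j‖ := by
          rw [hψ, hχ j, mul_one]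
          exact (pow_eq_one_iff_of_nonneg (norm_nonneg _) two_ne_zero).1 (by linarith)
        obtain ⟨r, -, hr⟩ := (norm_inner_eq_norm_iff (𝕜 := ℂ) (by rw [← norm_ne_zero_iff, hψ]; simp)
          (by rw [← norm_ne_zero_iff, hχ j]; simp)).1 h5
        have h6 : ‖r‖ = 1 := by
          have := hχ j
          rwa [hr, norm_smul, hψ, mul_one] at this
        rw [hr, geomImagPure_smul _ h6]
    rw [Finset.sum_congr rfl fun j _ => h3 j, ← Finset.sum_mul, hp1, one_mul]
  rw [geomImag, hset, csInf_singleton]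

end PureStates

/-! ### Extremal values over the fidelity ball -/

section Continuity

variable {ι : Type*} [Fintype ι] [DecidableEq ι]

/-- The imaginarity angle changes by at most the Bures angle. -/
lemma angle_le_add {ρ ρ' : Matrix ι ι ℂ} (hρ : IsState ρ) {f θ θ' : ℝ}
    (hf : f ≤ fidelity ρ ρ')
    (hθ : ∀ A B : Matrix ι ι ℂ, A * Aᴴ = ρ → IsRealMatrix B → ‖hsVec B‖ = 1 →
      θ ≤ Real.arccos ‖inner ℂ (hsVec B) (hsVec A)‖)
    (hθ0 : 0 ≤ θ') (hθ1 : θ' ≤ Real.pi / 2) {A' B' : Matrix ι ι ℂ} (hA' : A' * A'ᴴ = ρ')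
    (hA1 : ‖hsVec A'‖ = 1) (hB' : IsRealMatrix B') (hB1 : ‖hsVec B'‖ = 1)
    (hin : inner ℂ (hsVec B') (hsVec A') = (Real.cos θ' : ℂ)) :
    θ ≤ Real.arccos √f + θ' := by
  -- This `A` realises the fidelity with `A'`; the triangle inequality runs from `B'` through `A'`
  -- to `A`.
  obtain ⟨A, hA, h⟩ := exists_purification_inner_eq hρ.1 A'
  refine (hθ A B' hA hB' hB1).trans ((arccos_norm_inner_le_add hB1 hA1
    (norm_hsVec_eq_one (by rw [hA, hρ.2]))).trans ?_)
  rw [hin, Complex.norm_real, Real.norm_eq_abs, abs_of_nonneg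
    (Real.cos_nonneg_of_neg_pi_div_two_le_of_le (by linarith [Real.pi_pos]) hθ1),
    Real.arccos_cos hθ0 (by linarith [Real.pi_pos]), add_comm]
  gcongr
  rw [norm_inner_symm, h, hA', Complex.norm_real, Real.norm_eq_abs,
    abs_of_nonneg (rootFidelity_nonneg _ _)]
  exact Real.sqrt_le_iff.2 ⟨rootFidelity_nonneg _ _, hf⟩

lemma sq_sin_le_sq_sin {a b : ℝ} (ha : 0 ≤ a) (hab : a ≤ b) (hb : b ≤ Real.pi / 2) :
    Real.sin a ^ 2 ≤ Real.sin b ^ 2 :=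
  pow_le_pow_left₀ (Real.sin_nonneg_of_nonneg_of_le_pi ha (by linarith [Real.pi_pos]))
    (Real.sin_le_sin_of_le_of_le_pi_div_two (by linarith [Real.pi_pos]) hb hab) 2

lemma arcsin_sqrt_sin_sq {a : ℝ} (ha : 0 ≤ a) (ha' : a ≤ Real.pi / 2) :
    Real.arcsin √(Real.sin a ^ 2) = a := by
  rw [Real.sqrt_sq (Real.sin_nonneg_of_nonneg_of_le_pi ha (by linarith [Real.pi_pos])),
    Real.arcsin_sin (by linarith [Real.pi_pos]) ha']

/-- If two purifications have overlap at least `cos α`, where `α = arccos √f`, then the fidelity of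
the purified states is at least `f`. -/
lemma le_fidelity_of_inner_eq_cos {κ : Type*} [Fintype κ] {f : ℝ} (hf1 : f ≤ 1)
    {A A' : Matrix ι κ ℂ} {β : ℝ} (hβ0 : 0 ≤ β) (hβ : β ≤ Real.arccos √f)
    (h : ‖inner ℂ (hsVec A) (hsVec A')‖ = Real.cos β) :
    f ≤ fidelity (A * Aᴴ) (A' * A'ᴴ) := by
  have h1 := norm_inner_hsVec_le A A'
  have h2 : √f ≤ Real.cos β := by
    rw [← Real.cos_arccos (by linarith [Real.sqrt_nonneg f]) (Real.sqrt_le_one.2 hf1)]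
    exact Real.cos_le_cos_of_nonneg_of_le_pi hβ0 (Real.arccos_le_pi _) hβ
  rw [fidelity_eq_sq]
  exact (Real.sqrt_le_iff.1 ((h2.trans h.ge).trans h1)).2

theorem isLeast_geomImag_fidelityBall {f : ℝ} (hf1 : f ≤ 1) {ρ : Matrix ι ι ℂ}
    (hρ : IsState ρ) :
    IsLeast (geomImag '' fidelityBall ρ f)
      (Real.sin (max (Real.arcsin √(geomImag ρ) - Real.arccos √f) 0) ^ 2) := by
  have := hρ.nonempty
  obtain ⟨θ, h0, h1, hg, ⟨A, B, hA, hB, hB1, hin⟩, hmax⟩ := exists_angle hρ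
  rw [hg, arcsin_sqrt_sin_sq h0 h1]
  have hα0 := Real.arccos_nonneg √f
  have lower : ∀ ρ' ∈ fidelityBall ρ f,
      Real.sin (max (θ - Real.arccos √f) 0) ^ 2 ≤ geomImag ρ' := by
    rintro ρ' ⟨hρ', hf'⟩
    obtain ⟨θ', h0', h1', hg', ⟨A', B', hA', hB', hB1', hin'⟩, -⟩ := exists_angle hρ'
    have hA1' : ‖hsVec A'‖ = 1 := norm_hsVec_eq_one (by rw [hA', hρ'.2])
    have := angle_le_add hρ hf' hmax h0' h1' hA' hA1' hB' hB1' hin'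
    rw [hg']
    exact sq_sin_le_sq_sin (le_max_right _ _) (max_le (by linarith) h0') h1'
  set γ := max (θ - Real.arccos √f) 0 with hγ
  have hγ0 : 0 ≤ γ := le_max_right _ _
  have hγθ : γ ≤ θ := max_le (by linarith) h0
  have hγα : θ - γ ≤ Real.arccos √f := by linarith [le_max_left (θ - Real.arccos √f) 0]
  have hA1 : ‖hsVec A‖ = 1 := norm_hsVec_eq_one (by rw [hA, hρ.2])
  -- Move from `A` towards `B` by `arccos √f`, or stop at `B` if it is closer. The overlap with `B`
  -- bounds the imaginarity of the new state by `sin² γ`.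
  obtain ⟨z, hz, hyz, hxz⟩ := exists_geodesic_point hA1 hB1 h1 hγ0 hγθ hin
  obtain ⟨A', rfl⟩ : ∃ A' : Matrix ι ι ℂ, hsVec A' = z := ⟨of fun i j => z (i, j), rfl⟩
  have hst : IsState (A' * A'ᴴ) := isState_of_norm_hsVec_eq_one hz
  have hmem : A' * A'ᴴ ∈ fidelityBall ρ f := by
    refine ⟨hst, ?_⟩
    rw [← hA]
    refine le_fidelity_of_inner_eq_cos hf1 (β := θ - γ) (by linarith) hγα ?_
    rw [hxz, Complex.norm_real, Real.norm_eq_abs, abs_of_nonneg]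
    exact Real.cos_nonneg_of_neg_pi_div_two_le_of_le (by linarith [Real.pi_pos]) (by linarith)
  refine ⟨⟨A' * A'ᴴ, hmem, le_antisymm ?_ (lower _ hmem)⟩, ?_⟩
  · refine (geomImag_mul_conjTranspose_le hst.2 hB hB1).trans ?_
    rw [hyz, Complex.norm_real, Real.norm_eq_abs, sq_abs, Real.sin_sq]
  · rintro _ ⟨ρ', h, rfl⟩
    exact lower ρ' h

theorem isGreatest_geomImag_fidelityBall_ketBra {f : ℝ} (hf1 : f ≤ 1)
    (hι : 2 ≤ Fintype.card ι) {ψ : EuclideanSpace ℂ ι} (hψ : ‖ψ‖ = 1) :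
    IsGreatest (geomImag '' fidelityBall (ketBra ψ) f)
      (Real.sin (min (Real.arcsin √(geomImagPure ψ) + Real.arccos √f) (Real.pi / 4)) ^ 2) := by
  have hpi := Real.pi_pos
  have hα0 := Real.arccos_nonneg √f
  have hψs := isState_ketBra hψ
  obtain ⟨θ, h0, h1, hg, ⟨A, B, hA, hB, hB1, hin⟩, -⟩ := exists_angle hψs
  rw [geomImag_ketBra hψ] at hg
  refine ⟨?_, ?_⟩
  · obtain ⟨c, e, e', η, hc, he, he', hee, hη0, hη1, rfl⟩ := exists_eq_smul_canonicalState hι hψ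
    rw [geomImagPure_smul _ hc, geomImagPure_canonicalState he he' hee hη0 hη1,
      arcsin_sqrt_sin_sq hη0 (by linarith)]
    -- The maximiser stays in the plane of `e` and `e'`, where the angle between states is the
    -- difference of parameters.
    set η' := min (η + Real.arccos √f) (Real.pi / 4) with hη'
    have hle : η ≤ η' := le_min (by linarith) hη1
    have hη'1 : η' ≤ Real.pi / 4 := min_le_right _ _
    have hη'2 : η' ≤ η + Real.arccos √f := min_le_left _ _
    have hn := norm_canonicalState he he' hee η'
    refine ⟨ketBra (canonicalState e e' η'), ⟨isState_ketBra hn, ?_⟩, ?_⟩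
    · rw [← colMatrix_mul_conjTranspose, ← colMatrix_mul_conjTranspose]
      refine le_fidelity_of_inner_eq_cos hf1 (β := η' - η) (by linarith) (by linarith) ?_
      rw [inner_hsVec_colMatrix, inner_smul_left, inner_canonicalState he he' hee, norm_mul,
        RCLike.norm_conj, hc, one_mul, Complex.norm_real, Real.norm_eq_abs, ← Real.cos_neg, neg_sub,
        abs_of_nonneg]
      exact Real.cos_nonneg_of_neg_pi_div_two_le_of_le (by linarith) (by linarith)
    · rw [geomImag_ketBra hn, geomImagPure_canonicalState he he' hee (by linarith) hη'1]
  · rintro _ ⟨ρ', ⟨hρ', hf'⟩, rfl⟩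
    obtain ⟨θ', h0', h1', hg', -, hmax'⟩ := exists_angle hρ'
    -- Here `ρ'` is the state whose angle is bounded, so the fidelity is needed with its arguments
    -- swapped.
    have hf'' : f ≤ fidelity ρ' (ketBra ψ) :=
      hf'.trans (pow_le_pow_left₀ (rootFidelity_nonneg _ _)
        (rootFidelity_le_comm hψs.1 hρ'.1) 2)
    have h2 := angle_le_add hρ' hf'' hmax' h0 h1 hA
      (norm_hsVec_eq_one (by rw [hA, hψs.2])) hB hB1 hin
    rw [hg, arcsin_sqrt_sin_sq h0 h1]
    rcases min_cases (θ + Real.arccos √f) (Real.pi / 4) with ⟨h3, h4⟩ | ⟨h3, -⟩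
    · rw [h3, hg']
      exact sq_sin_le_sq_sin h0' (by linarith) (by linarith)
    · rw [h3, Real.sin_pi_div_four, div_pow, Real.sq_sqrt (by norm_num)]
      linarith [geomImag_le_half hι hρ']

end Continuity

end Imaginarity

theorem mainTheorem4 {ι : Type*} [Fintype ι] [DecidableEq ι] (f : ℝ) (hf0 : 0 ≤ f) (hf1 : f ≤ 1) :
    (∀ ρ : Matrix ι ι ℂ, Imaginarity.IsState ρ →
      IsLeast (Imaginarity.geomImag '' Imaginarity.fidelityBall ρ f)
        (Real.sin (max (Real.arcsin (Real.sqrt (Imaginarity.geomImag ρ))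
          - Real.arccos (Real.sqrt f)) 0) ^ 2)) ∧
    (2 ≤ Fintype.card ι → ∀ ψ : EuclideanSpace ℂ ι, ‖ψ‖ = 1 →
      IsGreatest (Imaginarity.geomImag '' Imaginarity.fidelityBall (Imaginarity.ketBra ψ) f)
        (Real.sin (min (Real.arcsin (Real.sqrt (Imaginarity.geomImagPure ψ))
          + Real.arccos (Real.sqrt f)) (Real.pi / 4)) ^ 2)) :=
  ⟨fun _ hρ => Imaginarity.isLeast_geomImag_fidelityBall hf1 hρ,
    fun hι _ hψ => Imaginarity.isGreatest_geomImag_fidelityBall_ketBra hf1 hι hψ⟩
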